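/- Let $\gamma=\frac{1+\sqrt5}2$, let $\lambda=-1/\gamma=\frac{1-\sqrt5}2$, and let $\lambda'=\gamma$ be the algebraic conjugate of $\lambda$. Let $T:[0,1)^2\to[0,1)^2$ be the bijection $T(x,y)=(y,\{-x-\lambda' y\})$, where $\{u\}=u-\lfloor u\rfloor$. For $z\in[0,1)^2$ let $\pi(z)$ be the minimal period length of the sequence $(T^k(z))_{k\in\mathbb Z}$ if this sequence is periodic, and $\pi(z)=\infty$ otherwise. Then: 1. $\pi(z)$ is finite for every $z\in(\mathbb Z[\gamma]\cap[0,1))^2$. 2. Every integer sequence $(a_k)_{k\in\mathbb Z}$ satisfying $0\le a_{k-1}+\lambda a_k+a_{k+1}<1$ for all $k\in\mathbb Z$ is periodic. 3. The point $\left(1-\frac1{3\gamma},\,1-\frac2{3\gamma}\right)\in[0,1)^2$ satisfies $\pi\left(1-\frac1{3\gamma},\,1-\frac2{3\gamma}\right)=\infty$. -/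

import Mathlib

namespace PiecewiseRotation

/-- The half-open unit square `[0,1)²`. -/
abbrev Square : Type := Set.Ico (0 : ℝ) 1 × Set.Ico (0 : ℝ) 1

/-- The fractional part `{x} = x - ⌊x⌋`, as an element of `[0,1)`. -/
noncomputable def frac (x : ℝ) : Set.Ico (0 : ℝ) 1 :=
  ⟨Int.fract x, Int.fract_nonneg x, Int.fract_lt_one x⟩

theorem frac_cancel (c : ℝ) (x : Set.Ico (0 : ℝ) 1) :
    frac (-(frac (-(x : ℝ) - c) : ℝ) - c) = x := by
  apply Subtype.ext
  change Int.fract (-Int.fract (-(x : ℝ) - c) - c) = x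
  have h : -Int.fract (-(x : ℝ) - c) - c = (x : ℝ) + (⌊-(x : ℝ) - c⌋ : ℤ) := by
    rw [Int.fract]; ring
  rw [h, Int.fract_add_intCast]
  exact Int.fract_eq_self.2 x.2

/-- The map `T (x, y) = (y, {-x - μ y})` of `[0,1)²` (in applications `μ` is the algebraic
conjugate `λ'` of a quadratic parameter `λ`), bundled with its inverse
`(u, v) ↦ ({-v - μ u}, u)`, so that `T ^ k` makes sense for every integer `k`. -/
noncomputable def T (μ : ℝ) : Equiv.Perm Square where
  toFun z := (z.2, frac (-(z.1 : ℝ) - μ * (z.2 : ℝ)))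
  invFun w := (frac (-(w.2 : ℝ) - μ * (w.1 : ℝ)), w.1)
  left_inv z := Prod.ext (frac_cancel (μ * (z.2 : ℝ)) z.1) rfl
  right_inv w := Prod.ext rfl (frac_cancel (μ * (w.1 : ℝ)) w.2)

/-- `p` is a (positive) period of the two-sided sequence `(T ^ k (z))`, `k ∈ ℤ`. -/
def IsPeriod (μ : ℝ) (z : Square) (p : ℕ) : Prop :=
  0 < p ∧ ∀ k : ℤ, (T μ ^ (k + (p : ℤ))) z = (T μ ^ k) z

/-- The minimal period length of `(T ^ k (z))`, `k ∈ ℤ`; it is `⊤` (that is, `∞`) if the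
sequence is not periodic. -/
noncomputable def period (μ : ℝ) (z : Square) : ℕ∞ :=
  ⨅ (p : ℕ) (_ : IsPeriod μ z p), (p : ℕ∞)

end PiecewiseRotation

namespace PiecewiseRotation

open Real

/-! ### Integers of `ℚ(√5)` -/

/-! Write φ for the golden ratio and ψ for its conjugate. On each strip where the digit m is
constant, `T φ` is the affine map (x, y) ↦ (y, m - x - φy). Its linear part has trace -φ =
2cos(4π/5), hence order five, and preserves x² + φxy + y². An iterate is therefore a rotation plus a
translation in ℤ[φ]², and it is the identity where the rotation is trivial and the translation
vanishes. Polygons with sides in ten fixed directions are stable under these maps, so finite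
searches over them can be done in exact arithmetic.

Such a search shows that each point is periodic or reaches the triangle x + φy > 2
(`search_square`). Let `shrink` be the contraction by φ⁻² towards (1, 1). The first return map of
the triangle has three affine pieces, and `shrink` carries each return to a longer orbit segment
(`exists_returns`). Hence `shrink` maps orbits between points of the triangle into orbits and
preserves periodicity there.

Points over ℤ[φ] are handled by descent. A point of the triangle is periodic or reaches `shrink w`
with w in the triangle (`search_triangle`, `exists_eq_shrink`). In the conjugate embedding the
linear part preserves x² + ψxy + y², the accumulated translations are bounded, and undoing `shrink`
multiplies this form by ψ⁴. The conjugate norm of the displacement from (1, 1) thus decays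
geometrically along the descent, while it is at least 15 on the triangle.

An integer sequence as in the second claim gives a `T φ`-orbit over ℤ[φ], and irrationality of ψ
recovers the sequence from it. For the third claim, the orbit enters a cycle of four points, each of
which reaches the `shrink` of the next. It therefore comes arbitrarily close to (1, 1) without
reaching it, so it is infinite. -/

/-- The real number `a + b φ` attached to a pair `(a, b)`. -/
noncomputable def toReal (p : ℤ × ℤ) : ℝ := p.1 + p.2 * goldenRatio

/-- The algebraic conjugate `a + b ψ` of `a + b φ`. -/
noncomputable def toConj (p : ℤ × ℤ) : ℝ := p.1 + p.2 * goldenConj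

/-- Multiplication by `φ` on coefficient pairs. -/
def mulPhi (p : ℤ × ℤ) : ℤ × ℤ := (p.2, p.1 + p.2)

/-- Multiplication by `φ⁻¹ = φ - 1` on coefficient pairs. -/
def divPhi (p : ℤ × ℤ) : ℤ × ℤ := (p.2 - p.1, p.1)

/-- A sufficient test for `0 < a + b φ`. -/
def isPos (p : ℤ × ℤ) : Bool :=
  decide (0 < 1000000 * p.1 + 1618033 * p.2) && decide (0 < 1000000 * p.1 + 1618034 * p.2)

theorem goldenRatio_lower : (1.618033 : ℝ) < goldenRatio := by
  nlinarith [goldenRatio_sq, goldenRatio_pos]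

theorem goldenRatio_upper : goldenRatio < (1.618034 : ℝ) := by
  nlinarith [goldenRatio_sq, goldenRatio_pos]

@[simp] theorem toReal_add (p q : ℤ × ℤ) : toReal (p + q) = toReal p + toReal q := by
  simp [toReal]; ring

@[simp] theorem toReal_sub (p q : ℤ × ℤ) : toReal (p - q) = toReal p - toReal q := by
  simp [toReal]; ring

@[simp] theorem toReal_neg (p : ℤ × ℤ) : toReal (-p) = -toReal p := by
  simp [toReal]; ring

theorem toReal_mk (a b : ℤ) : toReal (a, b) = a + b * goldenRatio := rfl

@[simp] theorem toReal_zero : toReal 0 = 0 := by simp [toReal]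

@[simp] theorem toReal_mulPhi (p : ℤ × ℤ) : toReal (mulPhi p) = goldenRatio * toReal p := by
  simp only [toReal, mulPhi]; push_cast; linear_combination (-(p.2 : ℝ)) * goldenRatio_sq

@[simp] theorem toReal_divPhi (p : ℤ × ℤ) :
    toReal (divPhi p) = (goldenRatio - 1) * toReal p := by
  simp only [toReal, divPhi]; push_cast; linear_combination (-(p.2 : ℝ)) * goldenRatio_sq

@[simp] theorem toConj_add (p q : ℤ × ℤ) : toConj (p + q) = toConj p + toConj q := by
  simp [toConj]; ring

@[simp] theorem toConj_sub (p q : ℤ × ℤ) : toConj (p - q) = toConj p - toConj q := by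
  simp [toConj]; ring

@[simp] theorem toConj_mulPhi (p : ℤ × ℤ) : toConj (mulPhi p) = goldenConj * toConj p := by
  simp only [toConj, mulPhi]; push_cast; linear_combination (-(p.2 : ℝ)) * goldenConj_sq

/-- An affine function of φ that is positive at both ends of a rational interval around φ is
positive at φ. -/
theorem toReal_pos {p : ℤ × ℤ} (h : isPos p = true) : 0 < toReal p := by
  simp only [isPos, Bool.and_eq_true, decide_eq_true_eq] at h
  obtain ⟨h1, h2⟩ := h
  have h1' : (0 : ℝ) < 1000000 * p.1 + 1618033 * p.2 := by exact_mod_cast h1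
  have h2' : (0 : ℝ) < 1000000 * p.1 + 1618034 * p.2 := by exact_mod_cast h2
  have hl := goldenRatio_lower
  have hu := goldenRatio_upper
  unfold toReal
  rcases le_total 0 (p.2 : ℝ) with h | h <;> nlinarith

/-! ### The ten linear forms -/

/-- The linear forms on `ℝ²` obtained from `(x, y) ↦ x` by the rotations of order ten of the
quadratic form `x² + φ x y + y²`. -/
noncomputable def form : ℕ → ℝ × ℝ → ℝ
  | 0, z => z.1
  | 1, z => goldenRatio * z.1 + z.2
  | n + 2, z => goldenRatio * form (n + 1) z - form n z

theorem form_add_two (n : ℕ) (z : ℝ × ℝ) :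
    form (n + 2) z = goldenRatio * form (n + 1) z - form n z := rfl

theorem form_add_three (n : ℕ) (z : ℝ × ℝ) :
    form (n + 3) z = goldenRatio * form (n + 1) z - goldenRatio * form n z := by
  rw [form_add_two (n + 1), form_add_two n]
  linear_combination form (n + 1) z * goldenRatio_sq

theorem form_add_four (n : ℕ) (z : ℝ × ℝ) :
    form (n + 4) z = form (n + 1) z - goldenRatio * form n z := by
  rw [form_add_two (n + 2), form_add_three n, form_add_two n]
  linear_combination (form (n + 1) z - form n z) * goldenRatio_sq

/-- The recurrence has trace φ = 2cos(π/5): one index step is a turn by π/5, and five steps are a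
half turn. -/
theorem form_add_five (n : ℕ) (z : ℝ × ℝ) : form (n + 5) z = -form n z := by
  rw [form_add_two (n + 3), form_add_four n, form_add_three n]
  linear_combination (-form n z) * goldenRatio_sq

theorem form_add_ten (n : ℕ) (z : ℝ × ℝ) : form (n + 10) z = form n z := by
  rw [form_add_five (n + 5), form_add_five n, neg_neg]

theorem form_mod (n : ℕ) (z : ℝ × ℝ) : form n z = form (n % 10) z := by
  induction n using Nat.strong_induction_on with
  | _ n ih =>
    rcases lt_or_ge n 10 with h | h
    · rw [Nat.mod_eq_of_lt h]
    · obtain ⟨k, rfl⟩ := Nat.exists_eq_add_of_le' h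
      rw [form_add_ten, ih k (by omega), Nat.add_mod_right]

theorem form_add (n : ℕ) (z w : ℝ × ℝ) : form n (z + w) = form n z + form n w := by
  induction n using Nat.twoStepInduction with
  | zero => rfl
  | one => simp [form]; ring
  | more n h1 h2 => rw [form_add_two, form_add_two, form_add_two, h1, h2]; ring

theorem form_smul (n : ℕ) (c : ℝ) (z : ℝ × ℝ) : form n (c • z) = c * form n z := by
  induction n using Nat.twoStepInduction with
  | zero => rfl
  | one => simp [form]; ring
  | more n h1 h2 => rw [form_add_two, form_add_two, h1, h2]; ring

theorem form_three (z : ℝ × ℝ) : form 3 z = z.1 + goldenRatio * z.2 := by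
  rw [form_add_three 0]; simp only [form]; linear_combination z.1 * goldenRatio_sq

theorem form_four (z : ℝ × ℝ) : form 4 z = z.2 := by
  rw [form_add_four 0]; simp only [form]; ring

theorem form_eight (z : ℝ × ℝ) : form 8 z = -(z.1 + goldenRatio * z.2) := by
  rw [form_add_five 3, form_three]

/-- Four index steps have trace 2cos(4π/5) = -φ, so the linear part of `T φ` advances the index by
four. -/
theorem form_add_eight (n : ℕ) (z : ℝ × ℝ) :
    form (n + 8) z = -form n z - goldenRatio * form (n + 4) z := by
  rw [form_add_five (n + 3), form_add_three, form_add_four]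
  linear_combination (-form n z) * goldenRatio_sq

/-! ### Polygons given by upper bounds on the ten forms -/

/-- An upper bound; the flag tells whether the bound may be attained. -/
abbrev Bound := (ℤ × ℤ) × Bool

/-- The real number `v` obeys the bound `b`. -/
def Bound.Holds (b : Bound) (v : ℝ) : Prop :=
  if b.2 = true then v ≤ toReal b.1 else v < toReal b.1

theorem Bound.Holds.le {b : Bound} {v : ℝ} (h : b.Holds v) : v ≤ toReal b.1 := by
  unfold Bound.Holds at h; split_ifs at h <;> linarith

theorem Bound.holds_of_lt {b : Bound} {v : ℝ} (h : v < toReal b.1) : b.Holds v := by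
  unfold Bound.Holds; split_ifs <;> linarith

theorem Bound.holds_true {p : ℤ × ℤ} {v : ℝ} : Bound.Holds (p, true) v ↔ v ≤ toReal p := by
  simp [Bound.Holds]

theorem Bound.holds_false {p : ℤ × ℤ} {v : ℝ} : Bound.Holds (p, false) v ↔ v < toReal p := by
  simp [Bound.Holds]

/-- The sum of two bounds. -/
def Bound.add (b c : Bound) : Bound := (b.1 + c.1, b.2 && c.2)

/-- A bound multiplied by `φ`. -/
def Bound.mul (b : Bound) : Bound := (mulPhi b.1, b.2)

/-- A bound divided by `φ`. -/
def Bound.div (b : Bound) : Bound := (divPhi b.1, b.2)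

/-- The sharper one of two bounds. -/
def Bound.min (b c : Bound) : Bound :=
  if isPos (c.1 - b.1) || (b.1 == c.1 && !b.2) then b else c

/-- A sufficient test for the bound `b` to imply the bound `c`. -/
def Bound.leq (b c : Bound) : Bool :=
  isPos (c.1 - b.1) || (b.1 == c.1 && (!b.2 || c.2))

theorem Bound.Holds.add {b c : Bound} {v w : ℝ} (hb : b.Holds v) (hc : c.Holds w) :
    (b.add c).Holds (v + w) := by
  obtain ⟨p, b⟩ := b
  obtain ⟨q, c⟩ := c
  cases b <;> cases c <;> simp [Bound.Holds, Bound.add] at * <;> linarith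

theorem Bound.Holds.mul {b : Bound} {v : ℝ} (hb : b.Holds v) :
    b.mul.Holds (goldenRatio * v) := by
  obtain ⟨p, b⟩ := b
  cases b <;> simp [Bound.Holds, Bound.mul] at * <;>
    nlinarith [goldenRatio_pos]

theorem Bound.Holds.div {b : Bound} {v : ℝ} (hb : b.Holds v) :
    b.div.Holds ((goldenRatio - 1) * v) := by
  have h : 0 < goldenRatio - 1 := sub_pos.2 one_lt_goldenRatio
  obtain ⟨p, b⟩ := b
  cases b <;> simp only [Bound.Holds, Bound.div, toReal_divPhi] at * <;> simp at * <;> nlinarith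

theorem Bound.Holds.min {b c : Bound} {v : ℝ} (hb : b.Holds v) (hc : c.Holds v) :
    (b.min c).Holds v := by
  unfold Bound.min; split_ifs <;> assumption

theorem Bound.Holds.of_leq {b c : Bound} {v : ℝ} (hb : b.Holds v) (h : b.leq c = true) :
    c.Holds v := by
  obtain ⟨p, b⟩ := b
  obtain ⟨q, c⟩ := c
  simp only [Bound.leq, Bool.or_eq_true, Bool.and_eq_true, beq_iff_eq] at h
  rcases h with h | ⟨rfl, h⟩
  · have h' := toReal_pos h
    have hb' := hb.le
    simp only [toReal_sub] at h' hb'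
    exact Bound.holds_of_lt (by simp only; linarith)
  · cases b <;> cases c <;> simp [Bound.Holds] at * <;> linarith

/-- The bound on the form `i`, read off from a list of ten bounds. -/
def getBound (B : List Bound) (i : ℕ) : Bound := B.getD (i % 10) ((0, 0), false)

/-- The list of the ten bounds `f 0, …, f 9`. -/
def ofFn (f : ℕ → Bound) : List Bound := [0, 1, 2, 3, 4, 5, 6, 7, 8, 9].map f

/-- The point `z` lies in the polygon given by `B`. -/
def InPoly (B : List Bound) (z : ℝ × ℝ) : Prop := ∀ i, (getBound B i).Holds (form i z)

theorem getBound_ofFn (f : ℕ → Bound) (i : ℕ) : getBound (ofFn f) i = f (i % 10) := by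
  have h : i % 10 < 10 := Nat.mod_lt _ (by norm_num)
  unfold getBound ofFn
  generalize i % 10 = j at h ⊢
  interval_cases j <;> rfl

theorem inPoly_ofFn {f : ℕ → Bound} {z : ℝ × ℝ} (h : ∀ i < 10, (f i).Holds (form i z)) :
    InPoly (ofFn f) z := fun i => by
  rw [getBound_ofFn, form_mod]
  exact h _ (Nat.mod_lt _ (by norm_num))

/-- Add the bound `b` on the form `i`. -/
def restrict (B : List Bound) (i : ℕ) (b : Bound) : List Bound :=
  ofFn fun j => if j = i then (getBound B j).min b else getBound B j

theorem InPoly.restrict {B : List Bound} {z : ℝ × ℝ} (h : InPoly B z) {i : ℕ} {b : Bound}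
    (hb : b.Holds (form i z)) : InPoly (restrict B i b) z :=
  inPoly_ofFn fun j _ => by
    split_ifs with hj
    · subst hj; exact (h j).min hb
    · exact h j

/-- Sharpen each bound by what the linear relations between three of the forms imply. -/
def tighten (B : List Bound) : List Bound :=
  ofFn fun i => (getBound B i).min
    (((getBound B (i + 9)).add (getBound B (i + 1))).div.min
    (((getBound B (i + 8)).add (getBound B (i + 2))).mul.min
    (((getBound B (i + 1)).mul.add (getBound B (i + 7))).min
    (((getBound B (i + 9)).mul.add (getBound B (i + 3))).min
    (((getBound B (i + 2)).div.add (getBound B (i + 9))).min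
    ((getBound B (i + 8)).div.add (getBound B (i + 1))))))))

/-- In each of the six relations the form is a combination of two others with positive coefficients,
so upper bounds can be combined. -/
theorem InPoly.tighten {B : List Bound} {z : ℝ × ℝ} (h : InPoly B z) : InPoly (tighten B) z := by
  refine inPoly_ofFn fun i _ => ?_
  have h2 := form_add_two i z
  have h3 := form_add_three i z
  have h4 := form_add_four i z
  have h7 := form_add_five (i + 2) z
  have h8 := form_add_five (i + 3) z
  have h9 := form_add_five (i + 4) z
  simp only [add_assoc, Nat.reduceAdd] at h7 h8 h9
  refine (h i).min (.min ?_ (.min ?_ (.min ?_ (.min ?_ (.min ?_ ?_)))))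
  · convert ((h (i + 9)).add (h (i + 1))).div using 1
    rw [h9, h4]; linear_combination (-form i z) * goldenRatio_sq
  · convert ((h (i + 8)).add (h (i + 2))).mul using 1
    rw [h8, h3, h2]; linear_combination (-form i z) * goldenRatio_sq
  · convert (h (i + 1)).mul.add (h (i + 7)) using 1
    rw [h7, h2]; ring
  · convert (h (i + 9)).mul.add (h (i + 3)) using 1
    rw [h9, h4, h3]; linear_combination (-form i z) * goldenRatio_sq
  · convert (h (i + 2)).div.add (h (i + 9)) using 1
    rw [h9, h4, h2]; linear_combination (-form (i + 1) z) * goldenRatio_sq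
  · convert (h (i + 8)).div.add (h (i + 1)) using 1
    rw [h8, h3]; linear_combination (form (i + 1) z - form i z) * goldenRatio_sq

/-- A sufficient test for the emptiness of a polygon. -/
def isEmpty (B : List Bound) : Bool :=
  [0, 1, 2, 3, 4].any fun i =>
    Bound.leq ((getBound B i).add (getBound B (i + 5))) ((0, 0), false)

theorem InPoly.not_isEmpty {B : List Bound} {z : ℝ × ℝ} (h : InPoly B z) : ¬ isEmpty B = true := by
  intro he
  simp only [isEmpty, List.any_eq_true] at he
  obtain ⟨i, _, hi⟩ := he
  have := ((h i).add (h (i + 5))).of_leq hi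
  rw [form_add_five, Bound.holds_false] at this
  simp [toReal] at this

/-! ### The dynamics on polygons -/

/-- The real coordinates of a point of the square. -/
def coords (z : Square) : ℝ × ℝ := (z.1, z.2)

theorem coords_injective : Function.Injective coords := fun z w h => by
  simp only [coords, Prod.mk.injEq] at h
  exact Prod.ext (Subtype.ext h.1) (Subtype.ext h.2)

/-- The affine map that agrees with `T φ` where the digit is `m`. -/
noncomputable def digitMap (m : ℤ) (v : ℝ × ℝ) : ℝ × ℝ := (v.2, m - v.1 - goldenRatio * v.2)

theorem coords_T {z : Square} {m : ℤ} (h0 : -(m : ℝ) ≤ form 8 (coords z))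
    (h1 : form 8 (coords z) < 1 - m) :
    coords (T goldenRatio z) = digitMap m (coords z) := by
  rw [form_eight] at h0 h1
  simp only [coords, digitMap, T, Equiv.coe_fn_mk, frac, Prod.mk.injEq, true_and] at *
  rw [Int.fract_eq_iff]
  refine ⟨by linarith, by linarith, -m, by push_cast; ring⟩

/-- Coefficients of the values of the forms at `(0, 1)`. -/
def formZeroOne (i : ℕ) : ℤ × ℤ :=
  [((0, 0) : ℤ × ℤ), (1, 0), (0, 1), (0, 1), (1, 0), (0, 0), (-1, 0), (0, -1), (0, -1),
    (-1, 0)].getD i (0, 0)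

/-- This is why polygons given by the ten forms map to such polygons: the bounds are rotated by four
places and translated. -/
theorem form_digitMap (m : ℤ) (v : ℝ × ℝ) {i : ℕ} (hi : i < 10) :
    form i (digitMap m v) = form (i + 4) v + m * toReal (formZeroOne i) := by
  have h : digitMap m v = (form 4 v, form 8 v) + (m : ℝ) • ((0, 1) : ℝ × ℝ) := by
    rw [form_four, form_eight]; ext <;> simp [digitMap]; ring
  have h1 : form i (form 4 v, form 8 v) = form (i + 4) v := by
    clear hi h
    induction i using Nat.twoStepInduction with
    | zero => rfl
    | one =>
      rw [form_add_five 0, form_add_five 3, form_four, form_three]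
      simp only [form]; ring
    | more n h1 h2 =>
      rw [form_add_two, h1, h2]; rfl
  rw [h, form_add, form_smul, h1]
  congr 2
  have key : ∀ j < 5, form j ((0, 1) : ℝ × ℝ) = toReal (formZeroOne j) := by
    intro j hj
    interval_cases j <;>
      simp [form, formZeroOne, toReal]
    · linear_combination goldenRatio_sq
    · linear_combination (goldenRatio + 1) * goldenRatio_sq
  rcases lt_or_ge i 5 with h5 | h5
  · exact key i h5
  · obtain ⟨j, rfl⟩ := Nat.exists_eq_add_of_le' h5
    rw [form_add_five, key j (by omega), ← toReal_neg]
    have : j < 5 := by omega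
    interval_cases j <;> rfl

/-- The image of a polygon under `digitMap m`. -/
def shift (B : List Bound) (m : ℤ) : List Bound :=
  ofFn fun i =>
    ((getBound B (i + 4)).1 + (m * (formZeroOne i).1, m * (formZeroOne i).2),
      (getBound B (i + 4)).2)

theorem InPoly.shift {B : List Bound} {v : ℝ × ℝ} (h : InPoly B v) (m : ℤ) :
    InPoly (shift B m) (digitMap m v) := by
  refine inPoly_ofFn fun i hi => ?_
  rw [form_digitMap m v hi]
  have h' := h (i + 4)
  have e : toReal (m * (formZeroOne i).1, m * (formZeroOne i).2) =
      m * toReal (formZeroOne i) := by simp [toReal]; ring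
  unfold Bound.Holds at h' ⊢
  simp only [toReal_add, e]
  split_ifs at h' ⊢ <;> linarith

/-- The `n`-th iterate of the linear part of `T φ`. -/
noncomputable def rot (n : ℕ) (v : ℝ × ℝ) : ℝ × ℝ := (form (4 * n) v, form (4 * n + 4) v)

theorem rot_zero (v : ℝ × ℝ) : rot 0 v = v := by
  unfold rot; rw [mul_zero, zero_add, form_four]; rfl

theorem rot_mod (n : ℕ) (v : ℝ × ℝ) : rot n v = rot (n % 5) v := by
  unfold rot
  rw [form_mod, form_mod (4 * n + 4), form_mod (4 * (n % 5)), form_mod (4 * (n % 5) + 4)]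
  congr 2 <;> omega

/-- The point of `ℝ²` with the given coefficient pairs. -/
noncomputable def toReal₂ (p q : ℤ × ℤ) : ℝ × ℝ := (toReal p, toReal q)

/-- The new last coordinate of the translation part after a step with digit `m`. -/
def nextOffset (m : ℤ) (c d : ℤ × ℤ) : ℤ × ℤ := (m, 0) - c - mulPhi d

/-- The rotation part is independent of the digits; only the translation, in ℤ[φ]², remembers them.
-/
theorem digitMap_rot (m : ℤ) (n : ℕ) (v : ℝ × ℝ) (c d : ℤ × ℤ) :
    digitMap m (rot n v + toReal₂ c d) = rot (n + 1) v + toReal₂ d (nextOffset m c d) := by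
  have h := form_add_eight (4 * n) v
  ext
  · simp [digitMap, rot, toReal₂]; ring_nf
  · simp only [digitMap, rot, toReal₂, nextOffset, Prod.fst_add, Prod.snd_add, toReal_sub,
      toReal_mulPhi, toReal_mk]
    rw [show 4 * (n + 1) + 4 = 4 * n + 8 by ring, h]
    push_cast; ring

/-! ### Following a word of digits -/

/-- Every point of the polygon `B` follows the word `w` of digits. -/
def follows : List Bound → List ℤ → Bool
  | _, [] => true
  | B, m :: w => (getBound B 8).leq ((1 - m, 0), false) && (getBound B 3).leq ((m, 0), true) &&
      follows (shift B m) w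

/-- The image of the polygon `B` along the word `w` of digits. -/
def shiftWord : List Bound → List ℤ → List Bound
  | B, [] => B
  | B, m :: w => shiftWord (shift B m) w

/-- The translation part of `T φ` iterated along the word `w` of digits. -/
def offsets : (ℤ × ℤ) × (ℤ × ℤ) → List ℤ → (ℤ × ℤ) × (ℤ × ℤ)
  | c, [] => c
  | c, m :: w => offsets (c.2, nextOffset m c.1 c.2) w

theorem step_of_leq {B : List Bound} {z : Square} (h : InPoly B (coords z)) {m : ℤ}
    (h1 : (getBound B 8).leq ((1 - m, 0), false) = true)
    (h2 : (getBound B 3).leq ((m, 0), true) = true) :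
    -(m : ℝ) ≤ form 8 (coords z) ∧ form 8 (coords z) < 1 - m := by
  have h1' := (h 8).of_leq h1
  have h2' := (h 3).of_leq h2
  rw [Bound.holds_false] at h1'
  rw [Bound.holds_true] at h2'
  rw [form_add_five 3] at h1' ⊢
  simp [toReal] at h1' h2'
  constructor <;> linarith

theorem inPoly_shiftWord {w : List ℤ} : ∀ {B : List Bound} {z : Square},
    InPoly B (coords z) → follows B w = true →
    InPoly (shiftWord B w) (coords ((T goldenRatio)^[w.length] z)) := by
  induction w with
  | nil => intro B z h _; exact h
  | cons m w ih =>
    intro B z h hf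
    simp only [follows, Bool.and_eq_true] at hf
    obtain ⟨h0, h1⟩ := step_of_leq h hf.1.1 hf.1.2
    rw [List.length_cons, Function.iterate_succ_apply]
    exact ih (coords_T h0 h1 ▸ h.shift m) hf.2

theorem coords_iterate_aux {w : List ℤ} : ∀ {B : List Bound} {z : Square} {v : ℝ × ℝ} {n : ℕ}
    {c : (ℤ × ℤ) × (ℤ × ℤ)}, InPoly B (coords z) → follows B w = true →
    coords z = rot n v + toReal₂ c.1 c.2 →
    coords ((T goldenRatio)^[w.length] z) =
      rot (n + w.length) v + toReal₂ (offsets c w).1 (offsets c w).2 := by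
  induction w with
  | nil => intro B z v n c _ _ hc; exact hc
  | cons m w ih =>
    intro B z v n c h hf hc
    simp only [follows, Bool.and_eq_true] at hf
    obtain ⟨h0, h1⟩ := step_of_leq h hf.1.1 hf.1.2
    have hT := coords_T h0 h1
    rw [List.length_cons, Function.iterate_succ_apply, add_comm w.length 1, ← add_assoc]
    refine ih (hT ▸ h.shift m) hf.2 ?_
    rw [hT, hc, digitMap_rot]

theorem coords_iterate {w : List ℤ} {B : List Bound} {z : Square}
    (h : InPoly B (coords z)) (hf : follows B w = true) :
    coords ((T goldenRatio)^[w.length] z) =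
      rot w.length (coords z) + toReal₂ (offsets 0 w).1 (offsets 0 w).2 := by
  have := coords_iterate_aux (n := 0) (v := coords z) (c := 0) h hf
    (by rw [rot_zero]; ext <;> simp [toReal₂])
  rwa [zero_add] at this

/-- The triangle on which the digit is `3`. -/
def InTriangle (z : Square) : Prop := 2 < (z.1 : ℝ) + goldenRatio * z.2

theorem inTriangle_iff {z : Square} : InTriangle z ↔ form 8 (coords z) < -2 := by
  rw [form_eight, InTriangle, neg_lt_neg_iff]; rfl

theorem not_inTriangle_of_follows {w : List ℤ} : ∀ {B : List Bound} {z : Square},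
    InPoly B (coords z) → follows B w = true → (∀ m ∈ w, m ≤ 2) →
    ∀ i < w.length, ¬ InTriangle ((T goldenRatio)^[i] z) := by
  induction w with
  | nil => intro B z _ _ _ i hi; simp at hi
  | cons m w ih =>
    intro B z h hf hw i hi
    simp only [follows, Bool.and_eq_true] at hf
    obtain ⟨h0, h1⟩ := step_of_leq h hf.1.1 hf.1.2
    cases i with
    | zero =>
      rw [inTriangle_iff]
      have : (m : ℝ) ≤ 2 := by exact_mod_cast hw m (by simp)
      simp only [Function.iterate_zero, id]
      linarith
    | succ i =>
      rw [Function.iterate_succ_apply]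
      exact ih (coords_T h0 h1 ▸ h.shift m) hf.2 (fun k hk => hw k (by simp [hk])) i
        (by simpa using hi)

/-! ### Exhaustive search -/

/-- Evaluate an integer before passing it on. -/
def forceInt {α : Type} (n : ℤ) (k : ℤ → α) : α :=
  match n with
  | Int.ofNat 0 => k (Int.ofNat 0)
  | Int.ofNat (m + 1) => k (Int.ofNat (m + 1))
  | Int.negSucc 0 => k (Int.negSucc 0)
  | Int.negSucc (m + 1) => k (Int.negSucc (m + 1))

theorem forceInt_eq {α : Type} (n : ℤ) (k : ℤ → α) : forceInt n k = k n := by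
  unfold forceInt; split <;> rfl

/-- Evaluate a coefficient pair before passing it on. -/
def forcePair {α : Type} (p : ℤ × ℤ) (k : ℤ × ℤ → α) : α :=
  forceInt p.1 fun a => forceInt p.2 fun b => k (a, b)

theorem forcePair_eq {α : Type} (p : ℤ × ℤ) (k : ℤ × ℤ → α) : forcePair p k = k p := by
  simp [forcePair, forceInt_eq]

/-- Evaluate a list of bounds before passing it on. -/
def forceBounds {α : Type} : List Bound → (List Bound → α) → α
  | [], k => k []
  | (p, f) :: B, k => forcePair p fun p => match f with
    | true => forceBounds B fun B => k ((p, true) :: B)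
    | false => forceBounds B fun B => k ((p, false) :: B)

theorem forceBounds_eq {α : Type} (B : List Bound) : ∀ k : List Bound → α,
    forceBounds B k = k B := by
  induction B with
  | nil => intro k; rfl
  | cons b B ih =>
    obtain ⟨p, f⟩ := b
    intro k
    cases f <;> simp [forceBounds, forcePair_eq, ih]

/-- The part of the polygon `B` with digit `m` on which `form 8` is at least `θ`. -/
def digitPart (θ : ℤ × ℤ) (m : ℤ) (B : List Bound) : List Bound :=
  restrict (restrict (restrict B 8 ((1 - m, 0), false)) 3 ((m, 0), true)) 3 (-θ, true)

/-- Search through the orbits of the points of the polygon `B`, whose points are images under the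
`n`-th iterate of `T φ` with translation part `(c, d)`. A branch is closed when this iterate is
the identity, and it must satisfy `fin n c d` when it reaches the half plane where `form 8` is
less than `θ`. -/
def search (θ : ℤ × ℤ) (fin : ℕ → ℤ × ℤ → ℤ × ℤ → Bool) :
    ℕ → List Bound → ℕ → ℤ × ℤ → ℤ × ℤ → Bool
  | 0, _, _, _, _ => false
  | fuel + 1, B, n, c, d =>
    (fin n c d || isEmpty (tighten (restrict B 8 (θ, false)))) &&
    [0, 1, 2, 3].all fun m =>
      forceBounds (digitPart θ m B) fun C => isEmpty C ||
        forceBounds (tighten C) fun C => isEmpty C ||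
        forcePair (nextOffset m c d) fun e =>
          ((n + 1) % 5 == 0 && d == 0 && e == 0) ||
            forceBounds (shift C m) fun C => search θ fin fuel C (n + 1) d e

theorem exists_digit (z : Square) : ∃ m ∈ ([0, 1, 2, 3] : List ℤ),
    -(m : ℝ) ≤ form 8 (coords z) ∧ form 8 (coords z) < 1 - m := by
  rw [form_eight]
  obtain ⟨⟨x, hx0, hx1⟩, ⟨y, hy0, hy1⟩⟩ := z
  have h0 := goldenRatio_pos
  have h1 := goldenRatio_lt_two
  have h : 0 ≤ goldenRatio * y := by positivity
  have h' : goldenRatio * y < 2 := by nlinarith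
  simp only [coords]
  rcases le_or_gt (x + goldenRatio * y) 0 with h2 | h2
  · exact ⟨0, by simp, by push_cast; linarith, by push_cast; linarith⟩
  rcases le_or_gt (x + goldenRatio * y) 1 with h3 | h3
  · exact ⟨1, by simp, by push_cast; linarith, by push_cast; linarith⟩
  rcases le_or_gt (x + goldenRatio * y) 2 with h4 | h4
  · exact ⟨2, by simp, by push_cast; linarith, by push_cast; linarith⟩
  · exact ⟨3, by simp, by push_cast; linarith, by push_cast; linarith⟩

/-- The digits cover the square, so the orbit of z follows some branch of the search and ends where
that branch is closed. -/
theorem search_sound {θ : ℤ × ℤ} {fin : ℕ → ℤ × ℤ → ℤ × ℤ → Bool} {z : Square} :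
    ∀ {fuel : ℕ} {B : List Bound} {n : ℕ} {c d : ℤ × ℤ}, search θ fin fuel B n c d = true →
    InPoly B (coords ((T goldenRatio)^[n] z)) →
    coords ((T goldenRatio)^[n] z) = rot n (coords z) + toReal₂ c d →
    z ∈ Function.periodicPts (T goldenRatio) ∨
    ∃ (n : ℕ) (c d : ℤ × ℤ), fin n c d = true ∧
      form 8 (coords ((T goldenRatio)^[n] z)) < toReal θ ∧
      coords ((T goldenRatio)^[n] z) = rot n (coords z) + toReal₂ c d := by
  intro fuel
  induction fuel with
  | zero => intro B n c d h; simp [search] at h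
  | succ fuel ih =>
    intro B n c d h hB hc
    simp only [search, Bool.and_eq_true, Bool.or_eq_true, List.all_eq_true, forceBounds_eq,
      forcePair_eq, beq_iff_eq] at h
    obtain ⟨hfin, hall⟩ := h
    rcases lt_or_ge (form 8 (coords ((T goldenRatio)^[n] z))) (toReal θ) with hθ | hθ
    · right
      rcases hfin with hfin | hfin
      · exact ⟨n, c, d, hfin, hθ, hc⟩
      · exact absurd hfin (hB.restrict (Bound.holds_false.2 hθ)).tighten.not_isEmpty
    · obtain ⟨m, hm, h0, h1⟩ := exists_digit ((T goldenRatio)^[n] z)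
      have h3 := form_add_five 3 (coords ((T goldenRatio)^[n] z))
      simp only [Nat.reduceAdd] at h3
      have hC : InPoly (digitPart θ m B) (coords ((T goldenRatio)^[n] z)) := by
        refine ((hB.restrict ?_).restrict ?_).restrict ?_
        · rw [Bound.holds_false]; simpa [toReal] using h1
        · rw [Bound.holds_true]; simp [toReal]; linarith
        · rw [Bound.holds_true, toReal_neg]; linarith
      have hT := coords_T h0 h1
      rw [hc, digitMap_rot, ← Function.iterate_succ_apply' (T goldenRatio)] at hT
      rcases hall m hm with h | h | ⟨⟨h5, hd⟩, he⟩ | h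
      · exact absurd h hC.not_isEmpty
      · exact absurd h hC.tighten.not_isEmpty
      -- The step count is divisible by five and the translation is zero, so the iterate fixes z.
      · left
        refine Function.mk_mem_periodicPts (n := n + 1) (by omega) (coords_injective ?_)
        rw [hT, he, hd, rot_mod, h5, rot_zero]
        ext <;> simp [toReal₂]
      · refine ih h ?_ hT
        rw [Function.iterate_succ_apply', coords_T h0 h1]
        exact hC.tighten.shift m

/-- Bounds for the unit square. -/
def squareBounds : List Bound :=
  [((1, 0), false), ((1, 1), false), ((0, 2), false), ((1, 1), false), ((1, 0), false),
    ((0, 0), true), ((0, 0), true), ((0, 0), true), ((0, 0), true), ((0, 0), true)]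

/-- Bounds for the triangle on which the digit is `3`. -/
def triangleBounds : List Bound := tighten (restrict squareBounds 8 ((-2, 0), false))

/-- Coefficients of the values of the forms at `(1, 1)`. -/
def formOne (i : ℕ) : ℤ × ℤ :=
  [((1, 0) : ℤ × ℤ), (1, 1), (0, 2), (1, 1), (1, 0), (-1, 0), (-1, -1), (0, -2), (-1, -1),
    (-1, 0)].getD (i % 10) (0, 0)

/-- The square of the norm, in the conjugate embedding, of a pair of elements of `ℤ[φ]`. -/
noncomputable def conjNorm (p q : ℤ × ℤ) : ℝ :=
  toConj p ^ 2 + goldenConj * (toConj p * toConj q) + toConj q ^ 2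

/-- The product of two elements of `ℤ[φ]` on coefficient pairs. -/
def mulPair (p q : ℤ × ℤ) : ℤ × ℤ :=
  (p.1 * q.1 + p.2 * q.2, p.1 * q.2 + p.2 * q.1 + p.2 * q.2)

/-- A sufficient test for `conjNorm p q < k`. -/
def conjNormLt (k : ℤ) (p q : ℤ × ℤ) : Bool :=
  forcePair (mulPair p p + mulPhi (mulPair p q) + mulPair q q) fun e =>
    isPos (k - e.1 - e.2, e.2)

/-- The translation part of an iterate of `T φ` in the coordinate `1 - z`, bounded in the
conjugate embedding. -/
def smallOffset (n : ℕ) (c d : ℤ × ℤ) : Bool :=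
  conjNormLt 32 ((1, 0) - formOne (4 * n) - c) ((1, 0) - formOne (4 * n + 4) - d)

/-- Any translation is accepted here, because no norm estimate is needed before the triangle is
entered. -/
theorem search_square :
    search (-2, 0) (fun _ _ _ => true) 30 squareBounds 0 0 0 = true := by
  decide +kernel

/-- The target x + φy > 4 - φ is the image of the triangle x + φy > 2 under `shrink`. -/
theorem search_triangle :
    search (-4, 1) smallOffset 80 triangleBounds 0 0 0 = true := by
  decide +kernel

/-! ### Starting polygons of the searches -/

theorem inPoly_of_lt {B : List Bound} {v : ℝ × ℝ} (h : ∀ i < 10, (getBound B i).Holds (form i v)) :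
    InPoly B v := fun i => by
  have := h (i % 10) (Nat.mod_lt _ (by norm_num))
  rwa [← form_mod, getBound, Nat.mod_mod] at this

theorem form_two (v : ℝ × ℝ) : form 2 v = goldenRatio * v.1 + goldenRatio * v.2 := by
  simp only [form]; linear_combination v.1 * goldenRatio_sq

theorem inPoly_squareBounds (z : Square) : InPoly squareBounds (coords z) := by
  have h0 := goldenRatio_pos
  have hx0 : 0 ≤ (coords z).1 := z.1.2.1
  have hx1 : (coords z).1 < 1 := z.1.2.2
  have hy0 : 0 ≤ (coords z).2 := z.2.2.1
  have hy1 : (coords z).2 < 1 := z.2.2.2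
  generalize coords z = v at *
  have hx2 : 0 ≤ goldenRatio * v.1 := by positivity
  have hy2 : 0 ≤ goldenRatio * v.2 := by positivity
  have hx3 : goldenRatio * v.1 < goldenRatio * 1 := by gcongr
  have hy3 : goldenRatio * v.2 < goldenRatio * 1 := by gcongr
  refine inPoly_of_lt fun i hi => ?_
  interval_cases i <;>
    (try simp only [form_add_five 0, form_add_five 1, form_add_five 2, form_add_five 3,
      form_add_five 4, form_three, form_four, form_two]) <;>
    simp only [getBound, squareBounds, Bound.Holds, toReal, form] <;> norm_num <;> linarith

theorem inPoly_triangleBounds {z : Square} (h : InTriangle z) :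
    InPoly triangleBounds (coords z) := by
  refine ((inPoly_squareBounds z).restrict ?_).tighten
  rw [Bound.holds_false]
  simpa [toReal] using inTriangle_iff.1 h

theorem form_one_one (n : ℕ) : form n (1, 1) = toReal (formOne n) := by
  have key : ∀ j < 5, form j ((1, 1) : ℝ × ℝ) = toReal (formOne j) := by
    intro j hj
    interval_cases j <;> (try simp only [form_three, form_four, form_two]) <;>
      simp [form, formOne, toReal] <;> ring
  rw [form_mod, show formOne n = formOne (n % 10) by rw [formOne, formOne, Nat.mod_mod]]
  have hn : n % 10 < 10 := Nat.mod_lt _ (by norm_num)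
  generalize n % 10 = i at hn ⊢
  rcases lt_or_ge i 5 with h5 | h5
  · exact key i h5
  · obtain ⟨j, rfl⟩ := Nat.exists_eq_add_of_le' h5
    rw [form_add_five, key j (by omega), ← toReal_neg]
    have : j < 5 := by omega
    interval_cases j <;> rfl

/-! ### The self-similarity -/

/-- The contraction with ratio `φ⁻²` towards `(1, 1)`. -/
noncomputable def shrink (z : Square) : Square :=
  have h (x : Set.Ico (0 : ℝ) 1) :
      (2 - goldenRatio) * (x : ℝ) + (goldenRatio - 1) ∈ Set.Ico (0 : ℝ) 1 := by
    have h1 := one_lt_goldenRatio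
    have h2 := goldenRatio_lt_two
    obtain ⟨x, h3, h4⟩ := x
    constructor <;> simp only <;> nlinarith
  (⟨_, h z.1⟩, ⟨_, h z.2⟩)

theorem coords_shrink (z : Square) : coords (shrink z) =
    (2 - goldenRatio) • coords z + (goldenRatio - 1) • ((1, 1) : ℝ × ℝ) := by
  ext <;> simp [coords, shrink]

/-- The image of a polygon under the contraction. -/
def shrinkBounds (B : List Bound) : List Bound :=
  ofFn fun i => (divPhi (divPhi (getBound B i).1) + divPhi (formOne i), (getBound B i).2)

theorem two_sub_goldenRatio : 2 - goldenRatio = (goldenRatio - 1) * (goldenRatio - 1) := by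
  linear_combination (-1 : ℝ) * goldenRatio_sq

theorem InPoly.shrink {B : List Bound} {z : Square} (h : InPoly B (coords z)) :
    InPoly (shrinkBounds B) (coords (shrink z)) := by
  refine inPoly_ofFn fun i _ => ?_
  have h' := (h i).div.div
  rw [coords_shrink, form_add, form_smul, form_smul, form_one_one, two_sub_goldenRatio, mul_assoc]
  unfold Bound.Holds Bound.div at h'
  unfold Bound.Holds
  simp only [toReal_add, toReal_divPhi] at h' ⊢
  split_ifs at h' ⊢ <;> linarith

/-- A sufficient test that the points of `B` return to the triangle first after following the word
`3 :: w`, and that the contraction carries this return into following the word `w'`. -/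
def returnsAlong (B : List Bound) (w w' : List ℤ) : Bool :=
  follows B (3 :: w) && w.all (fun m => decide (m ≤ 2)) &&
  (getBound (shiftWord B (3 :: w)) 8).leq ((-2, 0), false) &&
  follows (shrinkBounds B) w' && decide (w'.length % 5 = (3 :: w).length % 5) &&
  decide (divPhi (formOne (4 * w'.length)) + (offsets 0 w').1 =
    divPhi (divPhi (offsets 0 (3 :: w)).1) + divPhi (1, 0)) &&
  decide (divPhi (formOne (4 * w'.length + 4)) + (offsets 0 w').2 =
    divPhi (divPhi (offsets 0 (3 :: w)).2) + divPhi (1, 0)) &&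
  decide (0 < w'.length)

/-- `z` returns to the triangle first after `r` steps, and the contraction carries this return
into `s` steps. -/
def Returns (z : Square) (r s : ℕ) : Prop :=
  0 < r ∧ 0 < s ∧ (∀ i, 0 < i → i < r → ¬ InTriangle ((T goldenRatio)^[i] z)) ∧
    InTriangle ((T goldenRatio)^[r] z) ∧
    (T goldenRatio)^[s] (shrink z) = shrink ((T goldenRatio)^[r] z)

/-- Both sides are affine in z. Lengths congruent modulo five give equal linear parts, and the
offset conditions equate the translations. -/
theorem returns_of_returnsAlong {B : List Bound} {w w' : List ℤ} {z : Square}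
    (hB : InPoly B (coords z)) (h : returnsAlong B w w' = true) :
    ∃ r s, Returns z r s := by
  simp only [returnsAlong, Bool.and_eq_true, List.all_eq_true, decide_eq_true_eq] at h
  obtain ⟨⟨⟨⟨⟨⟨⟨hf, hw⟩, hend⟩, hf'⟩, hl⟩, ho1⟩, ho2⟩, hpos⟩ := h
  refine ⟨(3 :: w).length, w'.length, by simp, hpos, fun i hi0 hi => ?_, ?_, ?_⟩
  · obtain ⟨i, rfl⟩ := Nat.exists_eq_succ_of_ne_zero hi0.ne'
    have hf2 := hf
    simp only [follows, Bool.and_eq_true] at hf2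
    obtain ⟨h0, h1⟩ := step_of_leq hB hf2.1.1 hf2.1.2
    rw [Nat.succ_eq_add_one, Function.iterate_succ_apply]
    exact not_inTriangle_of_follows (coords_T h0 h1 ▸ hB.shift 3) hf2.2 hw i
      (by simpa using hi)
  · rw [inTriangle_iff]
    have := (inPoly_shiftWord hB hf 8).of_leq hend
    rw [Bound.holds_false] at this
    simpa [toReal] using this
  · apply coords_injective
    rw [coords_shrink, coords_iterate hB hf, coords_iterate hB.shrink hf', coords_shrink,
      rot_mod (List.length (3 :: w)), ← hl, ← rot_mod]
    apply_fun toReal at ho1 ho2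
    simp only [toReal_add, toReal_divPhi, ← form_one_one] at ho1 ho2
    ext
    · simp only [rot, form_add, form_smul, toReal₂, Prod.fst_add, Prod.smul_fst, smul_eq_mul,
        two_sub_goldenRatio] at *
      simp only [toReal] at ho1 ⊢
      push_cast at ho1 ⊢
      linarith
    · simp only [rot, form_add, form_smul, toReal₂, Prod.snd_add, Prod.smul_snd, smul_eq_mul,
        two_sub_goldenRatio] at *
      simp only [toReal] at ho2 ⊢
      push_cast at ho2 ⊢
      linarith

/-- The three pieces return after 5, 1 and 13 steps, along A = 32112, B = 3 and C = 3211221122112.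
The words `w'` come from the substitution A ↦ ABCB, B ↦ AB, C ↦ ABCBCBCB. -/
theorem exists_returns {z : Square} (h : InTriangle z) : ∃ r s, Returns z r s := by
  have hB := inPoly_triangleBounds h
  have h3 := form_add_five 3 (coords z)
  have h7 := form_add_five 2 (coords z)
  simp only [Nat.reduceAdd] at h3 h7
  rcases lt_or_ge (form 8 (coords z)) (toReal (-4, 1)) with h8 | h8
  · exact returns_of_returnsAlong (B := tighten (restrict triangleBounds 8 ((-4, 1), false)))
      (w := [2, 1, 1, 2])
      (w' := [3, 2, 1, 1, 2, 3, 3, 2, 1, 1, 2, 2, 1, 1, 2, 2, 1, 1, 2, 3])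
      (hB.restrict (Bound.holds_false.2 h8)).tighten (by decide +kernel)
  rcases lt_or_ge (form 2 (coords z)) (toReal (-2, 3)) with h2 | h2
  · exact returns_of_returnsAlong (B := tighten (restrict
      (restrict triangleBounds 3 ((4, -1), true)) 2 ((-2, 3), false)))
      (w := []) (w' := [3, 2, 1, 1, 2, 3])
      ((hB.restrict (Bound.holds_true.2 (by simp [toReal] at h8 ⊢; linarith))).restrict
        (Bound.holds_false.2 h2)).tighten (by decide +kernel)
  · exact returns_of_returnsAlong (B := tighten (restrict
      (restrict triangleBounds 3 ((4, -1), true)) 7 ((2, -3), true)))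
      (w := [2, 1, 1, 2, 2, 1, 1, 2, 2, 1, 1, 2])
      (w' := [3, 2, 1, 1, 2, 3, 3, 2, 1, 1, 2, 2, 1, 1, 2, 2, 1, 1, 2, 3, 3, 2, 1, 1, 2,
         2, 1, 1, 2, 2, 1, 1, 2, 3, 3, 2, 1, 1, 2, 2, 1, 1, 2, 2, 1, 1, 2, 3])
      ((hB.restrict (Bound.holds_true.2 (by simp [toReal] at h8 ⊢; linarith))).restrict
        (Bound.holds_true.2 (by simp [toReal] at h2 ⊢; linarith))).tighten (by decide +kernel)

/-- The contraction carries orbits within the triangle to orbits. -/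
theorem exists_iterate_shrink {z : Square} {n : ℕ} (h : InTriangle z)
    (hn : InTriangle ((T goldenRatio)^[n] z)) :
    ∃ s, (T goldenRatio)^[s] (shrink z) = shrink ((T goldenRatio)^[n] z) ∧ (0 < n → 0 < s) := by
  induction n using Nat.strong_induction_on generalizing z with
  | _ n ih =>
    rcases Nat.eq_zero_or_pos n with rfl | hn0
    · exact ⟨0, rfl, id⟩
    obtain ⟨r, s, hr, hs, hlt, hT, hshrink⟩ := exists_returns h
    have hrn : r ≤ n := by
      by_contra! hlt'
      exact hlt n hn0 hlt' hn
    -- Split off the first return; the remaining k steps again join points of the triangle.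
    obtain ⟨k, rfl⟩ := Nat.exists_eq_add_of_le' hrn
    rw [Function.iterate_add_apply] at hn ⊢
    obtain ⟨s', hs', _⟩ := ih k (by omega) hT hn
    exact ⟨s' + s, by rw [Function.iterate_add_apply, hshrink, hs'], fun _ => by omega⟩

theorem shrink_mem_periodicPts {z : Square} (h : InTriangle z)
    (hz : z ∈ Function.periodicPts (T goldenRatio)) :
    shrink z ∈ Function.periodicPts (T goldenRatio) := by
  obtain ⟨n, hn, hp⟩ := hz
  have hp' : (T goldenRatio)^[n] z = z := hp
  obtain ⟨s, hs, hpos⟩ := exists_iterate_shrink (n := n) h (by rwa [hp'])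
  rw [hp'] at hs
  exact ⟨s, hpos hn, hs⟩

/-! ### Points with coordinates in `ℤ[φ]` -/

/-- The forms on coefficient pairs. -/
def formPair : ℕ → ℤ × ℤ → ℤ × ℤ → ℤ × ℤ
  | 0, p, _ => p
  | 1, p, q => mulPhi p + q
  | n + 2, p, q => mulPhi (formPair (n + 1) p q) - formPair n p q

theorem toReal_formPair (n : ℕ) (p q : ℤ × ℤ) :
    toReal (formPair n p q) = form n (toReal₂ p q) := by
  induction n using Nat.twoStepInduction with
  | zero => rfl
  | one => simp [form, formPair, toReal₂]
  | more n h1 h2 => rw [form_add_two, ← h1, ← h2]; simp [formPair]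

theorem toReal_injective : Function.Injective toReal := fun p q h => by
  have h' : ((p.2 - q.2 : ℤ) : ℝ) * goldenRatio = ((q.1 - p.1 : ℤ) : ℝ) := by
    simp only [toReal] at h; push_cast; linarith
  have h2 : p.2 - q.2 = 0 := by
    by_contra hne
    exact (goldenRatio_irrational.intCast_mul hne).ne_int _ h'
  rw [h2] at h'
  have h1 : q.1 - p.1 = 0 := by
    have : ((q.1 - p.1 : ℤ) : ℝ) = 0 := by rw [← h']; simp
    exact_mod_cast this
  exact Prod.ext (by omega) (by omega)

theorem formPair_one_sub (n : ℕ) (p q : ℤ × ℤ) :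
    formPair n ((1, 0) - p) ((1, 0) - q) = formOne n - formPair n p q := by
  apply toReal_injective
  rw [toReal_sub, toReal_formPair, toReal_formPair, ← form_one_one, eq_sub_iff_add_eq,
    ← form_add]
  congr 1
  ext <;> simp [toReal₂, toReal_mk]

theorem toConj_formPair_add_four (n : ℕ) (p q : ℤ × ℤ) : toConj (formPair (n + 4) p q) =
    toConj (formPair (n + 1) p q) - goldenConj * toConj (formPair n p q) := by
  simp only [formPair, toConj_sub, toConj_mulPhi]
  generalize toConj (formPair (n + 1) p q) = a
  generalize toConj (formPair n p q) = b
  linear_combination (a * (goldenConj + 1) - b) * goldenConj_sq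

/-- Galois conjugate of the invariance of x² + φxy + y²; since |ψ| < 2 the conjugate form is also
definite. -/
theorem conjNorm_formPair (n : ℕ) (p q : ℤ × ℤ) :
    conjNorm (formPair n p q) (formPair (n + 4) p q) = conjNorm p q := by
  have h (n : ℕ) : conjNorm (formPair n p q) (formPair (n + 4) p q) =
      toConj (formPair n p q) ^ 2 -
        goldenConj * (toConj (formPair n p q) * toConj (formPair (n + 1) p q)) +
        toConj (formPair (n + 1) p q) ^ 2 := by
    rw [conjNorm, toConj_formPair_add_four]; ring
  rw [h]
  induction n with
  | zero => simp only [formPair, toConj_add, toConj_mulPhi, conjNorm]; ring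
  | succ n ih => rw [← ih, formPair, toConj_sub, toConj_mulPhi]; ring

theorem goldenConj_mem : -0.6181 < goldenConj ∧ goldenConj < -0.618 := by
  have h1 := goldenRatio_lower
  have h2 := goldenRatio_upper
  have h3 := goldenRatio_add_goldenConj
  constructor <;> linarith

theorem conjNorm_nonneg (p q : ℤ × ℤ) : 0 ≤ conjNorm p q := by
  obtain ⟨h1, h2⟩ := goldenConj_mem
  unfold conjNorm
  nlinarith [sq_nonneg (toConj p - toConj q), sq_nonneg (toConj p + toConj q),
    sq_nonneg (toConj p), sq_nonneg (toConj q)]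

theorem conjNorm_add_le (p q p' q' : ℤ × ℤ) :
    conjNorm (p + p') (q + q') ≤ 2 * conjNorm p q + 2 * conjNorm p' q' := by
  have := conjNorm_nonneg (p - p') (q - q')
  simp only [conjNorm, toConj_add, toConj_sub] at *
  linarith

theorem conjNorm_mulPhi (p q : ℤ × ℤ) :
    conjNorm (mulPhi p) (mulPhi q) = goldenConj ^ 2 * conjNorm p q := by
  simp only [conjNorm, toConj_mulPhi]; ring

theorem toConj_mulPair (p q : ℤ × ℤ) : toConj (mulPair p q) = toConj p * toConj q := by
  simp only [toConj, mulPair]; push_cast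
  linear_combination (-(p.2 : ℝ) * q.2) * goldenConj_sq

theorem conjNorm_lt {k : ℤ} {p q : ℤ × ℤ} (h : conjNormLt k p q = true) : conjNorm p q < k := by
  rw [conjNormLt, forcePair_eq] at h
  have h1 := toReal_pos h
  have h2 : conjNorm p q = toConj (mulPair p p + mulPhi (mulPair p q) + mulPair q q) := by
    simp only [conjNorm, toConj_add, toConj_mulPhi, toConj_mulPair]; ring
  have h3 := goldenRatio_add_goldenConj
  rw [h2]
  generalize mulPair p p + mulPhi (mulPair p q) + mulPair q q = e at *
  simp only [toReal, toConj] at *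
  push_cast at h1
  rw [show goldenConj = 1 - goldenRatio by linarith]
  linarith

/-- The extremal element is 2φ - 3, with conjugate -(2 + √5) ≈ -4.236. For |b| ≥ 3 the difference
b√5 from the conjugate is already too large. -/
theorem toConj_large {q : ℤ × ℤ} (h0 : 0 < toReal q) (h1 : toReal q < 2 - goldenRatio) :
    4.2 ^ 2 ≤ toConj q ^ 2 := by
  by_contra! h
  obtain ⟨h2, h3⟩ := abs_lt_of_sq_lt_sq' h (by norm_num)
  have hl := goldenRatio_lower
  have hu := goldenRatio_upper
  have hs := goldenRatio_add_goldenConj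
  obtain ⟨a, b⟩ := q
  simp only [toReal, toConj] at *
  rw [show goldenConj = 1 - goldenRatio by linarith] at h2 h3
  have hb1 : b < 3 := by
    by_contra! hb
    have : (3 : ℝ) ≤ b := by exact_mod_cast hb
    nlinarith
  have hb2 : -3 < b := by
    by_contra! hb
    have : (b : ℝ) ≤ -3 := by exact_mod_cast hb
    nlinarith
  have key (k : ℤ) : a ≤ k ∨ (k + 1 : ℝ) ≤ a := by
    rcases le_or_gt a k with h | h
    · exact .inl h
    · exact .inr (by exact_mod_cast h)
  have cast_le {k : ℤ} (h : a ≤ k) : (a : ℝ) ≤ k := by exact_mod_cast h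
  interval_cases b <;> push_cast at *
  · rcases key 3 with h | h
    · have := cast_le h; push_cast at this; linarith
    · push_cast at h; linarith
  · rcases key 1 with h | h
    · have := cast_le h; push_cast at this; linarith
    · push_cast at h; linarith
  · rcases key 0 with h | h
    · have := cast_le h; push_cast at this; linarith
    · push_cast at h; linarith
  · rcases key (-2) with h | h
    · have := cast_le h; push_cast at this; linarith
    · push_cast at h; linarith
  · rcases key (-4) with h | h
    · have := cast_le h; push_cast at this; linarith
    · rcases key (-3) with h' | h'
      · have := cast_le h'; push_cast at h this; linarith
      · push_cast at h'; linarith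

theorem le_conjNorm_of_inTriangle {z : Square} (h : InTriangle z) {p q : ℤ × ℤ}
    (hz : coords z = toReal₂ p q) : 15 ≤ conjNorm ((1, 0) - p) ((1, 0) - q) := by
  have hx : (coords z).1 < 1 := z.1.2.2
  have hy : (coords z).2 < 1 := z.2.2.2
  have ht : 2 < (coords z).1 + goldenRatio * (coords z).2 := h
  have hl := one_lt_goldenRatio
  have hsq := goldenRatio_sq
  rw [hz] at hx hy ht
  simp only [toReal₂] at hx hy ht
  have h1 : toReal (1, 0) = 1 := by simp [toReal]
  -- From x < 1 follows φy > 1, that is, y > 1/φ = φ - 1.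
  have hy' : goldenRatio - 1 < toReal q := by nlinarith
  have := toConj_large (q := (1, 0) - q) (by rw [toReal_sub]; linarith)
    (by rw [toReal_sub]; linarith)
  obtain ⟨h3, h4⟩ := goldenConj_mem
  unfold conjNorm
  generalize toConj ((1, 0) - q) = b at *
  generalize toConj ((1, 0) - p) = a at *
  have h5 : goldenConj ^ 2 < 0.3821 := by nlinarith
  -- Completing the square leaves (1 - ψ²/4)b², and 4.2²(1 - ψ²/4) > 15.
  nlinarith [sq_nonneg (a + goldenConj / 2 * b), sq_nonneg b]

theorem mem_periodicPts_of_iterate {z : Square} {n : ℕ}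
    (h : (T goldenRatio)^[n] z ∈ Function.periodicPts (T goldenRatio)) :
    z ∈ Function.periodicPts (T goldenRatio) := by
  obtain ⟨p, hp, h⟩ := h
  refine ⟨p, hp, (T goldenRatio).injective.iterate n ?_⟩
  rw [← Function.iterate_add_apply, add_comm, Function.iterate_add_apply]
  exact h

theorem exists_eq_shrink {z : Square} (h : form 8 (coords z) < toReal (-4, 1)) :
    ∃ w : Square, shrink w = z ∧ InTriangle w ∧
      1 - (w.1 : ℝ) = goldenRatio * (goldenRatio * (1 - z.1)) ∧
      1 - (w.2 : ℝ) = goldenRatio * (goldenRatio * (1 - z.2)) := by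
  rw [form_eight] at h
  simp only [coords, toReal] at h
  push_cast at h
  obtain ⟨⟨x, hx0, hx1⟩, ⟨y, hy0, hy1⟩⟩ := z
  simp only at h
  have h1 := one_lt_goldenRatio
  have h2 := goldenRatio_lt_two
  have hsq := goldenRatio_sq
  have key : 2 < (1 - goldenRatio * (goldenRatio * (1 - x))) +
      goldenRatio * (1 - goldenRatio * (goldenRatio * (1 - y))) := by
    have : goldenRatio ^ 2 * (4 - goldenRatio) < goldenRatio ^ 2 * (x + goldenRatio * y) :=
      mul_lt_mul_of_pos_left (by linarith) (by positivity)
    nlinarith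
  have hx : 1 - goldenRatio * (goldenRatio * (1 - x)) < 1 := by
    have : 0 < goldenRatio * (goldenRatio * (1 - x)) :=
      mul_pos (by linarith) (mul_pos (by linarith) (by linarith))
    linarith
  have hy : 1 - goldenRatio * (goldenRatio * (1 - y)) < 1 := by
    have : 0 < goldenRatio * (goldenRatio * (1 - y)) :=
      mul_pos (by linarith) (mul_pos (by linarith) (by linarith))
    linarith
  refine ⟨(⟨1 - goldenRatio * (goldenRatio * (1 - x)), ?_, hx⟩,
    ⟨1 - goldenRatio * (goldenRatio * (1 - y)), ?_, hy⟩), ?_, key, ?_, ?_⟩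
  · nlinarith
  · nlinarith
  · apply coords_injective
    rw [coords_shrink]
    ext
    · simp only [coords, Prod.fst_add, Prod.smul_fst, smul_eq_mul]
      linear_combination ((1 - x) * (goldenRatio - 1)) * hsq
    · simp only [coords, Prod.snd_add, Prod.smul_snd, smul_eq_mul]
      linear_combination ((1 - y) * (goldenRatio - 1)) * hsq
  · ring
  · ring

/-- Each descent step shrinks the norm by a factor 23/25; at n = 0 the hypothesis contradicts the
lower bound 15. -/
theorem mem_periodicPts_of_inTriangle (n : ℕ) : ∀ {z : Square} {p q : ℤ × ℤ}, InTriangle z →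
    coords z = toReal₂ p q →
    conjNorm ((1, 0) - p) ((1, 0) - q) < 15 * (25 / 23) ^ n →
    z ∈ Function.periodicPts (T goldenRatio) := by
  induction n with
  | zero =>
    intro z p q h hz hn
    have := le_conjNorm_of_inTriangle h hz
    norm_num at hn
    linarith
  | succ n ih =>
    intro z p q h hz hn
    have h15 := le_conjNorm_of_inTriangle h hz
    rcases search_sound (z := z) search_triangle (inPoly_triangleBounds h)
      (by rw [rot_zero]; ext <;> simp [toReal₂]) with hper | ⟨N, c, d, hfin, hθ, hc⟩
    · exact hper
    have hsmall := conjNorm_lt hfin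
    obtain ⟨w, hw, hwT, hw1, hw2⟩ := exists_eq_shrink hθ
    refine mem_periodicPts_of_iterate (n := N) (hw ▸ shrink_mem_periodicPts hwT ?_)
    set p' := formPair (4 * N) p q + c with hp'
    set q' := formPair (4 * N + 4) p q + d with hq'
    have hT : coords ((T goldenRatio)^[N] z) = toReal₂ p' q' := by
      rw [hc, hz]
      ext <;> simp [rot, toReal₂, toReal_formPair, hp', hq']
    -- Here 1 - T^N z is the rotated 1 - z plus an offset of norm below 32, and 64 = 2 · 32.
    have hle : conjNorm ((1, 0) - p') ((1, 0) - q') ≤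
        2 * conjNorm ((1, 0) - p) ((1, 0) - q) + 64 := by
      have h1 := conjNorm_add_le (formPair (4 * N) ((1, 0) - p) ((1, 0) - q))
        (formPair (4 * N + 4) ((1, 0) - p) ((1, 0) - q))
        ((1, 0) - formOne (4 * N) - c) ((1, 0) - formOne (4 * N + 4) - d)
      rw [conjNorm_formPair, formPair_one_sub, formPair_one_sub] at h1
      have e1 : (1, 0) - p' = formOne (4 * N) - formPair (4 * N) p q +
          ((1, 0) - formOne (4 * N) - c) := by rw [hp']; abel
      have e2 : (1, 0) - q' = formOne (4 * N + 4) - formPair (4 * N + 4) p q +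
          ((1, 0) - formOne (4 * N + 4) - d) := by rw [hq']; abel
      rw [e1, e2]
      push_cast at hsmall
      linarith
    refine ih (p := (1, 0) - mulPhi (mulPhi ((1, 0) - p')))
      (q := (1, 0) - mulPhi (mulPhi ((1, 0) - q'))) hwT ?_ ?_
    · have h1 : toReal (1, 0) = 1 := by simp [toReal]
      have hT1 := congrArg Prod.fst hT
      have hT2 := congrArg Prod.snd hT
      simp only [coords, toReal₂] at hT1 hT2
      ext
      · simp only [coords, toReal₂, toReal_sub, toReal_mulPhi, h1, ← hT1]; linarith
      · simp only [coords, toReal₂, toReal_sub, toReal_mulPhi, h1, ← hT2]; linarith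
    -- With K ≥ 15 the old norm, ψ⁴(2K + 64) ≤ ψ⁴(2 + 64/15)K < (23/25)K.
    · rw [sub_sub_cancel, sub_sub_cancel, conjNorm_mulPhi, conjNorm_mulPhi]
      obtain ⟨h3, h4⟩ := goldenConj_mem
      have h5 : goldenConj ^ 2 < 0.38198 := by
        rw [goldenConj_sq]
        linarith [goldenRatio_lower, goldenRatio_add_goldenConj]
      have h6 : goldenConj ^ 2 * goldenConj ^ 2 < 0.14592 := by
        nlinarith [sq_nonneg goldenConj]
      have h7 := conjNorm_nonneg ((1, 0) - p') ((1, 0) - q')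
      rw [pow_succ] at hn
      rw [← mul_assoc]
      nlinarith

theorem mem_periodicPts_of_coords {z : Square} {p q : ℤ × ℤ} (hz : coords z = toReal₂ p q) :
    z ∈ Function.periodicPts (T goldenRatio) := by
  rcases search_sound (z := z) search_square (inPoly_squareBounds z)
    (by rw [rot_zero]; ext <;> simp [toReal₂]) with hper | ⟨N, c, d, -, hθ, hc⟩
  · exact hper
  refine mem_periodicPts_of_iterate (n := N) ?_
  set p' := formPair (4 * N) p q + c with hp'
  set q' := formPair (4 * N + 4) p q + d with hq'
  have hT : coords ((T goldenRatio)^[N] z) = toReal₂ p' q' := by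
    rw [hc, hz]
    ext <;> simp [rot, toReal₂, toReal_formPair, hp', hq']
  obtain ⟨n, hn⟩ := pow_unbounded_of_one_lt (conjNorm ((1, 0) - p') ((1, 0) - q'))
    (show (1 : ℝ) < 25 / 23 by norm_num)
  refine mem_periodicPts_of_inTriangle n (inTriangle_iff.2 (by simpa [toReal] using hθ)) hT ?_
  have : (0 : ℝ) < (25 / 23) ^ n := by positivity
  linarith

/-! ### An aperiodic point -/

/-- The point `z` has the coordinates `p / 3` and `q / 3`. -/
def HasThirds (z : Square) (p q : ℤ × ℤ) : Prop :=
  (z.1 : ℝ) = toReal p / 3 ∧ (z.2 : ℝ) = toReal q / 3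

/-- The word `w` of digits leads from the point with coordinates `c.1 / 3, c.2 / 3` to the one with
coordinates `d.1 / 3, d.2 / 3`. -/
def leadsTo (d : (ℤ × ℤ) × (ℤ × ℤ)) : (ℤ × ℤ) × (ℤ × ℤ) → List ℤ → Bool
  | c, [] => c == d
  | c, m :: w => forcePair (nextOffset (3 * m) c.1 c.2) fun e =>
      (e == 0 || isPos e) && isPos ((3, 0) - e) && leadsTo d (c.2, e) w

theorem hasThirds_iterate_aux {d : (ℤ × ℤ) × (ℤ × ℤ)} {w : List ℤ} : ∀ {z : Square}
    {c : (ℤ × ℤ) × (ℤ × ℤ)}, HasThirds z c.1 c.2 → leadsTo d c w = true →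
    HasThirds ((T goldenRatio)^[w.length] z) d.1 d.2 := by
  induction w with
  | nil =>
    intro z c h hl
    simp only [leadsTo, beq_iff_eq] at hl
    exact hl ▸ h
  | cons m w ih =>
    intro z c h hl
    simp only [leadsTo, forcePair_eq, Bool.and_eq_true, Bool.or_eq_true,
      beq_iff_eq] at hl
    obtain ⟨⟨h0, h3⟩, hl⟩ := hl
    have h3 := toReal_pos h3
    have h0 : 0 ≤ toReal (nextOffset (3 * m) c.1 c.2) := by
      rcases h0 with h0 | h0
      · rw [h0, toReal_zero]
      · exact (toReal_pos h0).le
    obtain ⟨h1, h2⟩ := h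
    have e : toReal (nextOffset (3 * m) c.1 c.2) = 3 * (m + form 8 (coords z)) := by
      rw [form_eight]
      simp only [nextOffset, coords, toReal_sub, toReal_mulPhi, toReal_mk, h1, h2]
      push_cast; ring
    rw [toReal_sub, e, toReal_mk] at h3
    rw [e] at h0
    push_cast at h3
    have hT := coords_T (z := z) (m := m) (by linarith) (by linarith)
    rw [List.length_cons, Function.iterate_succ_apply]
    refine ih ⟨?_, ?_⟩ hl
    · rw [show (((T goldenRatio) z).1 : ℝ) = z.2 from rfl, h2]
    · rw [e, show (((T goldenRatio) z).2 : ℝ) = (coords (T goldenRatio z)).2 from rfl, hT,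
        form_eight]
      simp only [digitMap, coords]; ring

theorem HasThirds.iterate {z : Square} {p q : ℤ × ℤ} (h : HasThirds z p q) (w : List ℤ)
    (p' q' : ℤ × ℤ) (hl : leadsTo (p', q') (p, q) w = true) :
    HasThirds ((T goldenRatio)^[w.length] z) p' q' :=
  hasThirds_iterate_aux (c := (p, q)) (d := (p', q')) h hl

theorem HasThirds.eq {z w : Square} {p q : ℤ × ℤ} (hz : HasThirds z p q) (hw : HasThirds w p q) :
    z = w :=
  Prod.ext (Subtype.ext (hz.1.trans hw.1.symm)) (Subtype.ext (hz.2.trans hw.2.symm))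

theorem HasThirds.inTriangle {z : Square} {p q : ℤ × ℤ} (hz : HasThirds z p q)
    (h : isPos (p + mulPhi q - (6, 0)) = true) : InTriangle z := by
  have h := toReal_pos h
  rw [toReal_sub, toReal_add, toReal_mulPhi, toReal_mk 6 0] at h
  push_cast at h
  unfold InTriangle
  rw [hz.1, hz.2]
  linarith

theorem HasThirds.shrink {z : Square} {p q p' q' : ℤ × ℤ} (hz : HasThirds z p q)
    (hp : divPhi (divPhi p) + divPhi (3, 0) = p') (hq : divPhi (divPhi q) + divPhi (3, 0) = q') :
    HasThirds (shrink z) p' q' := by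
  subst hp hq
  constructor
  · simp only [PiecewiseRotation.shrink, hz.1, toReal_add, toReal_divPhi, toReal_mk,
      two_sub_goldenRatio]
    push_cast; ring
  · simp only [PiecewiseRotation.shrink, hz.2, toReal_add, toReal_divPhi, toReal_mk,
      two_sub_goldenRatio]
    push_cast; ring

theorem exists_hasThirds {p q : ℤ × ℤ}
    (h : (isPos p && isPos ((3, 0) - p) && isPos q && isPos ((3, 0) - q)) = true) :
    ∃ z : Square, HasThirds z p q := by
  simp only [Bool.and_eq_true] at h
  obtain ⟨⟨⟨h1, h2⟩, h3⟩, h4⟩ := h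
  have h1 := toReal_pos h1
  have h2 := toReal_pos h2
  have h3 := toReal_pos h3
  have h4 := toReal_pos h4
  rw [toReal_sub, toReal_mk] at h2 h4
  push_cast at h2 h4
  exact ⟨(⟨toReal p / 3, by linarith, by linarith⟩, ⟨toReal q / 3, by linarith, by linarith⟩),
    rfl, rfl⟩

/-- The points in the self-similar cycle. -/
def InCycle (z : Square) : Prop :=
  HasThirds z (-1, 2) (4, -1) ∨ HasThirds z (-3, 3) (-2, 3) ∨ HasThirds z (-3, 3) (1, 1) ∨
    HasThirds z (2, 0) (6, -2)

theorem InCycle.inTriangle {z : Square} (h : InCycle z) : InTriangle z := by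
  rcases h with h | h | h | h <;> exact h.inTriangle (by decide)

/-- The explicit digit words are itineraries ending at the contracted successor, whose coordinates
are listed in thirds. -/
theorem InCycle.exists_shrink {z : Square} (h : InCycle z) :
    ∃ (w : Square) (n : ℕ), InCycle w ∧ (T goldenRatio)^[n] z = shrink w := by
  rcases h with h | h | h | h
  · obtain ⟨w, hw⟩ := exists_hasThirds (p := (-3, 3)) (q := (-2, 3)) (by decide)
    exact ⟨w, _, .inr (.inl hw), (h.iterate
      [3, 3, 2, 1, 1, 2, 2, 1, 1, 2, 2, 1, 1, 2, 3, 3, 2, 1, 1, 2, 2, 1, 1, 2, 2, 1, 1, 2, 3]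
      (-12, 9) (-10, 8) (by decide +kernel)).eq (hw.shrink rfl rfl)⟩
  · obtain ⟨w, hw⟩ := exists_hasThirds (p := (-3, 3)) (q := (1, 1)) (by decide)
    exact ⟨w, _, .inr (.inr (.inl hw)), (h.iterate [3, 3, 2, 1, 1, 2, 2, 1, 1, 2, 2, 1, 1, 2, 3]
      (-12, 9) (-2, 3) (by decide +kernel)).eq (hw.shrink rfl rfl)⟩
  · obtain ⟨w, hw⟩ := exists_hasThirds (p := (2, 0)) (q := (6, -2)) (by decide)
    exact ⟨w, _, .inr (.inr (.inr hw)),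
      (h.iterate [3] (1, 1) (11, -5) (by decide +kernel)).eq (hw.shrink rfl rfl)⟩
  · obtain ⟨w, hw⟩ := exists_hasThirds (p := (-1, 2)) (q := (4, -1)) (by decide)
    exact ⟨w, _, .inl hw, (h.iterate [3, 3, 2, 1, 1, 2, 2, 1, 1, 2, 2, 1, 1, 2, 3]
      (-7, 6) (6, -2) (by decide +kernel)).eq (hw.shrink rfl rfl)⟩

theorem InTriangle.shrink {z : Square} (h : InTriangle z) : InTriangle (shrink z) := by
  have h1 := one_lt_goldenRatio
  have h2 := goldenRatio_lt_two
  simp only [InTriangle, PiecewiseRotation.shrink] at *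
  nlinarith

theorem exists_iterate_shrink_iterate {z : Square} {n : ℕ} (h : InTriangle z)
    (hn : InTriangle ((T goldenRatio)^[n] z)) (j : ℕ) :
    ∃ s, (T goldenRatio)^[s] (shrink^[j] z) = shrink^[j] ((T goldenRatio)^[n] z) := by
  induction j generalizing z n with
  | zero => exact ⟨n, rfl⟩
  | succ j ih =>
    obtain ⟨s, hs, -⟩ := exists_iterate_shrink h hn
    rw [Function.iterate_succ_apply, Function.iterate_succ_apply, ← hs]
    exact ih h.shrink (hs ▸ hn.shrink)

theorem InCycle.exists_shrink_iterate {z : Square} (h : InCycle z) (j : ℕ) :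
    ∃ (w : Square) (n : ℕ), (T goldenRatio)^[n] z = shrink^[j] w := by
  -- The induction needs w to stay in the cycle, so that its own passage to `shrink w'` can be
  -- contracted j times.
  suffices ∃ (w : Square) (n : ℕ), InCycle w ∧ (T goldenRatio)^[n] z = shrink^[j] w by
    obtain ⟨w, n, _, h⟩ := this
    exact ⟨w, n, h⟩
  induction j with
  | zero => exact ⟨z, 0, h, rfl⟩
  | succ j ih =>
    obtain ⟨w, n, hw, hn⟩ := ih
    obtain ⟨w', n', hw', hn'⟩ := hw.exists_shrink
    obtain ⟨s, hs⟩ := exists_iterate_shrink_iterate (n := n') hw.inTriangle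
      (hn' ▸ hw'.inTriangle.shrink) j
    refine ⟨w', s + n, hw', ?_⟩
    rw [Function.iterate_add_apply, hn, hs, hn', Function.iterate_succ_apply]

theorem one_sub_shrink_iterate (z : Square) (j : ℕ) :
    1 - ((shrink^[j] z).1 : ℝ) = (2 - goldenRatio) ^ j * (1 - z.1) := by
  induction j with
  | zero => simp
  | succ j ih =>
    rw [Function.iterate_succ_apply', pow_succ', mul_assoc, ← ih]
    simp only [shrink]; ring

/-- A finite orbit has a least value of 1 - x, which is positive; the orbit nevertheless meets
`shrink^[j] w`, where 1 - x ≤ (2 - φ)^j. -/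
theorem InCycle.not_mem_periodicPts {z : Square} (h : InCycle z) :
    z ∉ Function.periodicPts (T goldenRatio) := by
  rintro ⟨p, hp, hper⟩
  have hfin : (Set.range fun n => (T goldenRatio)^[n] z).Finite := by
    refine ((Finset.range p).finite_toSet.image fun n => (T goldenRatio)^[n] z).subset ?_
    rintro _ ⟨n, rfl⟩
    exact ⟨n % p, by simpa using Nat.mod_lt n hp, hper.iterate_mod_apply n⟩
  obtain ⟨m, ⟨n, rfl⟩, hm⟩ := Set.exists_min_image _ (fun w : Square => 1 - (w.1 : ℝ)) hfin
    (Set.range_nonempty _)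
  have hpos : 0 < 1 - (((T goldenRatio)^[n] z).1 : ℝ) := sub_pos.2 ((T goldenRatio)^[n] z).1.2.2
  obtain ⟨j, hj⟩ := exists_pow_lt_of_lt_one hpos
    (show 2 - goldenRatio < 1 by linarith [one_lt_goldenRatio])
  obtain ⟨w, k, hk⟩ := h.exists_shrink_iterate j
  have h1 := hm _ ⟨k, hk⟩
  rw [one_sub_shrink_iterate] at h1
  have h2 : (0 : ℝ) < (2 - goldenRatio) ^ j := pow_pos (sub_pos.2 goldenRatio_lt_two) j
  have h3 : (0 : ℝ) ≤ (w.1 : ℝ) := w.1.2.1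
  nlinarith

theorem not_mem_periodicPts {z : Square} (hz : HasThirds z (4, -1) (5, -2)) :
    z ∉ Function.periodicPts (T goldenRatio) := by
  rintro ⟨p, hp, hper⟩
  -- Four steps lead into the cycle.
  have h := hz.iterate [2, 1, 1, 2] (-1, 2) (4, -1) (by decide)
  exact InCycle.not_mem_periodicPts (.inl h) ⟨p, hp, hper.apply_iterate _⟩

/-! ### Periods -/

theorem isPeriod_iff {z : Square} {p : ℕ} {μ : ℝ} :
    IsPeriod μ z p ↔ 0 < p ∧ Function.IsPeriodicPt (T μ) p z := by
  have h : (T μ ^ (p : ℤ)) z = (T μ)^[p] z := by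
    rw [zpow_natCast, Equiv.Perm.iterate_eq_pow]
  refine and_congr_right fun _ => ⟨fun hk => ?_, fun hper k => ?_⟩
  · have := hk 0
    rw [zero_add, h, zpow_zero] at this
    exact this
  · rw [zpow_add, Equiv.Perm.mul_apply, h, hper.eq]

theorem period_lt_top {z : Square} {μ : ℝ} (h : z ∈ Function.periodicPts (T μ)) :
    period μ z < ⊤ := by
  obtain ⟨p, hp, hper⟩ := h
  exact (iInf₂_le p (isPeriod_iff.2 ⟨hp, hper⟩)).trans_lt (ENat.natCast_lt_top p)

theorem period_eq_top {z : Square} {μ : ℝ} (h : z ∉ Function.periodicPts (T μ)) :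
    period μ z = ⊤ :=
  iInf₂_eq_top.2 fun _ hp => absurd ⟨_, isPeriod_iff.1 hp⟩ h

theorem exists_eq_toReal {x : ℝ} (hx : x ∈ Algebra.adjoin ℤ {goldenRatio}) :
    ∃ p, x = toReal p := by
  induction hx using Algebra.adjoin_induction with
  | mem x hx => exact ⟨(0, 1), by rw [Set.mem_singleton_iff.1 hx]; simp [toReal]⟩
  | algebraMap n => exact ⟨(n, 0), by simp [toReal]⟩
  | add x y _ _ hx hy =>
    obtain ⟨p, rfl⟩ := hx
    obtain ⟨q, rfl⟩ := hy
    exact ⟨p + q, (toReal_add p q).symm⟩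
  | mul x y _ _ hx hy =>
    obtain ⟨p, rfl⟩ := hx
    obtain ⟨q, rfl⟩ := hy
    refine ⟨mulPair p q, ?_⟩
    simp only [toReal, mulPair]; push_cast
    linear_combination ((p.2 : ℝ) * q.2) * goldenRatio_sq

/-- The bounded sequences `a` of integers correspond to orbits of `T φ`. -/
theorem exists_period_of_sequence {a : ℤ → ℤ}
    (ha : ∀ k : ℤ, 0 ≤ (a (k - 1) : ℝ) + goldenConj * a k + a (k + 1) ∧
      (a (k - 1) : ℝ) + goldenConj * a k + a (k + 1) < 1) :
    ∃ p : ℤ, 0 < p ∧ ∀ k : ℤ, a (k + p) = a k := by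
  have hψ : goldenConj = 1 - goldenRatio := by linarith [goldenRatio_add_goldenConj]
  let r (k : ℤ) : Set.Ico (0 : ℝ) 1 := ⟨(a (k - 1) : ℝ) + goldenConj * a k + a (k + 1), ha k⟩
  have hr (k : ℤ) : (r k : ℝ) = (a (k - 1) : ℝ) + goldenConj * a k + a (k + 1) := rfl
  have hT (k : ℤ) : T goldenRatio (r k, r (k + 1)) = (r (k + 1), r (k + 1 + 1)) := by
    refine Prod.ext rfl (Subtype.ext (Int.fract_eq_iff.2 ⟨(r _).2.1, (r _).2.2, ?_⟩))
    -- By φ + ψ = 1 and φψ = -1, r k + φ r (k+1) + r (k+2) is the sum of five consecutive terms of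
    -- a.
    refine ⟨-a (k - 1) - a k - a (k + 1) - a (k + 1 + 1) - a (k + 1 + 1 + 1), ?_⟩
    simp only [hr, hψ, add_sub_cancel_right]
    push_cast
    linear_combination (a (k + 1) : ℝ) * goldenRatio_sq
  obtain ⟨p, hp, hper⟩ := mem_periodicPts_of_coords (z := (r 0, r 1))
    (p := (a (-1) + a 0 + a 1, -a 0)) (q := (a 0 + a 1 + a 2, -a 1)) (by
      ext
      · simp only [coords, hr, hψ, toReal₂, toReal]; norm_num; ring
      · simp only [coords, hr, hψ, toReal₂, toReal]; norm_num; ring)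
  have horbit (k : ℤ) : (T goldenRatio ^ k) (r 0, r 1) = (r k, r (k + 1)) := by
    induction k using Int.induction_on with
    | zero => rfl
    | succ n ih => rw [add_comm, zpow_add, Equiv.Perm.mul_apply, ih, zpow_one, hT, add_comm]
    | pred n ih =>
      rw [sub_eq_neg_add, zpow_add, Equiv.Perm.mul_apply, ih, zpow_neg, zpow_one,
        Equiv.Perm.inv_eq_iff_eq, hT]
      ring_nf
  refine ⟨p, by exact_mod_cast hp, fun k => ?_⟩
  have h := (isPeriod_iff.2 ⟨hp, hper⟩).2 k
  rw [horbit, horbit] at h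
  have h := congrArg (fun w : Square => (w.1 : ℝ)) h
  simp only [hr] at h
  by_contra hne
  have hne' : a k - a (k + p) ≠ 0 := sub_ne_zero.2 (Ne.symm hne)
  -- Equality of r at k and k + p makes (a k - a (k+p))ψ an integer.
  refine (goldenConj_irrational.intCast_mul hne').ne_int
    (a (k + p - 1) + a (k + p + 1) - a (k - 1) - a (k + 1)) ?_
  push_cast
  linarith

end PiecewiseRotation

theorem mainTheorem4 (lam lam' γ : ℝ) (hγ : γ = (1 + Real.sqrt 5) / 2)
    (hlam : lam = (1 - Real.sqrt 5) / 2) (hlam' : lam' = (1 + Real.sqrt 5) / 2) :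
    (∀ z : PiecewiseRotation.Square,
      (z.1 : ℝ) ∈ Algebra.adjoin ℤ {γ} → (z.2 : ℝ) ∈ Algebra.adjoin ℤ {γ} →
        PiecewiseRotation.period lam' z < ⊤) ∧
    (∀ a : ℤ → ℤ,
      (∀ k : ℤ, 0 ≤ (a (k - 1) : ℝ) + lam * (a k : ℝ) + (a (k + 1) : ℝ) ∧
        (a (k - 1) : ℝ) + lam * (a k : ℝ) + (a (k + 1) : ℝ) < 1) →
      ∃ p : ℤ, 0 < p ∧ ∀ k : ℤ, a (k + p) = a k) ∧
    (∃ z : PiecewiseRotation.Square,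
      (z.1 : ℝ) = 1 - 1 / (3 * γ) ∧ (z.2 : ℝ) = 1 - 2 / (3 * γ) ∧
        PiecewiseRotation.period lam' z = ⊤) := by
  obtain rfl : γ = Real.goldenRatio := hγ
  obtain rfl : lam = Real.goldenConj := hlam
  obtain rfl : lam' = Real.goldenRatio := hlam'
  refine ⟨fun z h1 h2 => ?_, fun a ha => PiecewiseRotation.exists_period_of_sequence ha, ?_⟩
  · obtain ⟨p, hp⟩ := PiecewiseRotation.exists_eq_toReal h1
    obtain ⟨q, hq⟩ := PiecewiseRotation.exists_eq_toReal h2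
    exact PiecewiseRotation.period_lt_top
      (PiecewiseRotation.mem_periodicPts_of_coords (Prod.ext hp hq))
  · obtain ⟨z, hz⟩ := PiecewiseRotation.exists_hasThirds (p := (4, -1)) (q := (5, -2)) (by decide)
    have h (c : ℝ) : c / (3 * Real.goldenRatio) = c * (Real.goldenRatio - 1) / 3 := by
      rw [div_eq_div_iff (by positivity) (by norm_num)]
      linear_combination (-3 * c) * Real.goldenRatio_sq
    refine ⟨z, ?_, ?_, PiecewiseRotation.period_eq_top (PiecewiseRotation.not_mem_periodicPts hz)⟩
    · rw [hz.1, PiecewiseRotation.toReal_mk, h]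
      push_cast; ring
    · rw [hz.2, PiecewiseRotation.toReal_mk, h]
      push_cast; ring
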